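/- Let $k$ be a field, let $n = 6p + d$ with integers $p \ge 0$ and $0 \le d \le 5$, and let $S = k[x_1,\ldots,x_n]$ with the standard grading. Let $P_n^2$ be the square of the path graph, that is, the graph on the vertices $x_1,\ldots,x_n$ with the edges $\{x_i,x_{i+1}\}$ ($1\le i\le n-1$) and $\{x_i,x_{i+2}\}$ ($1\le i\le n-2$), and let $NI(P_n^2) \subseteq S$ be its closed neighborhood ideal, that is, the ideal generated by the monomials $\prod_{x_j \in N[x_i]} x_j$, $1\le i\le n$, where $N[x_i]$ is the set consisting of $x_i$ and its neighbors. Then the Castelnuovo–Mumford regularity and the projective dimension of the $S$-module $S/NI(P_n^2)$ are $$\operatorname{reg}\left(\frac{S}{NI(P_n^2)}\right)=\begin{cases}4p,& d\in\{0,1\}\\ 4p+1,& d=2\\ 4p+2,& d\in\{3,4\}\\ 4p+3,& d=5\end{cases}$$ and $$\operatorname{pd}\left(\frac{S}{NI(P_n^2)}\right)=\begin{cases}2p,& d=0\\ 2p+1,& d\in\{1,2,3\}\\ 2p+2,& d\in\{4,5\}.\end{cases}$$ Here $\operatorname{reg}(M)$ is the maximum of $j-i$ over all $i,j$ such that $S(-j)$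 is a direct summand of the $i$-th free module in the minimal graded free resolution of $M$. -/

import Mathlib

open MvPolynomial

/-- The square `P_n^2` of the path graph on the vertices `0, …, n - 1`: the edges of the path
together with all the pairs `{i, i + 2}`. -/
def pathSquare (n : ℕ) : SimpleGraph (Fin n) :=
  SimpleGraph.pathGraph n ⊔ SimpleGraph.fromRel (fun i j : Fin n => i.val + 2 = j.val)

open Classical in
/-- The closed neighborhood ideal `NI(G)` in the polynomial ring over `k` whose variables are the
vertices of `G`: it is generated by the monomials `∏_{u ∈ N[v]} x_u`, for `v` a vertex. -/
noncomputable def closedNeighborhoodIdeal (k : Type*) [Field k] {V : Type*} [Fintype V]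
    (G : SimpleGraph V) : Ideal (MvPolynomial V k) :=
  Ideal.span (Set.range fun v : V => ∏ u ∈ insert v (G.neighborFinset v), X u)

/-- The standard grading of `S / I` for a homogeneous ideal `I` of `S = k[x_v : v ∈ V]`
(every variable has degree `1`): its component of degree `j : ℤ` is the image of the space of
homogeneous polynomials of degree `j` (which is zero for `j < 0`). -/
noncomputable def quotientGrading {k : Type*} [Field k] {V : Type*} (I : Ideal (MvPolynomial V k))
    (j : ℤ) : Submodule k (MvPolynomial V k ⧸ I) :=
  (weightedHomogeneousSubmodule k (fun _ : V => (1 : ℤ)) j).map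
    (Ideal.Quotient.mkₐ k I).toLinearMap

/-- A minimal graded free resolution `⋯ → F₁ → F₀ → M → 0` of a finitely generated graded module
`M = ⨁_j ℳ j` over the standard graded polynomial ring `S = k[x_v : v ∈ V]`.
Here `F_i = ⨁_a S(-shift i a)` with `a` ranging over `Fin (rank i)`, so that the basis vector `e_a`
of `F_i` is homogeneous of degree `shift i a`; all maps are homogeneous of degree `0`, and
minimality means that the image of `F_{i+1}` lies in `𝔪 F_i`, where `𝔪` is the ideal generated by
the variables. -/
structure MinimalGradedFreeResolution {k : Type*} [Field k] {V : Type*} {M : Type*}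
    [AddCommGroup M] [Module (MvPolynomial V k) M] [Module k M]
    (ℳ : ℤ → Submodule k M) where
  /-- the rank of `F_i` -/
  rank : ℕ → ℕ
  /-- the degrees of the basis vectors of `F_i` -/
  shift : (i : ℕ) → Fin (rank i) → ℤ
  /-- the differential `F_{i+1} → F_i` -/
  d : (i : ℕ) →
    (Fin (rank (i + 1)) → MvPolynomial V k) →ₗ[MvPolynomial V k] (Fin (rank i) → MvPolynomial V k)
  /-- the augmentation `F₀ → M` -/
  ε : (Fin (rank 0) → MvPolynomial V k) →ₗ[MvPolynomial V k] M
  d_homogeneous : ∀ (i : ℕ) (b : Fin (rank (i + 1))) (a : Fin (rank i)),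
    IsWeightedHomogeneous (fun _ : V => (1 : ℤ)) (d i (Pi.single b 1) a)
      (shift (i + 1) b - shift i a)
  ε_homogeneous : ∀ b : Fin (rank 0), ε (Pi.single b 1) ∈ ℳ (shift 0 b)
  ε_surjective : Function.Surjective ε
  exact_zero : Function.Exact (d 0) ε
  exact_succ : ∀ i : ℕ, Function.Exact (d (i + 1)) (d i)
  minimal : ∀ (i : ℕ) (b : Fin (rank (i + 1))) (a : Fin (rank i)),
    d i (Pi.single b 1) a ∈ Ideal.span (Set.range (X : V → MvPolynomial V k))

/-- The Castelnuovo–Mumford regularity of a finitely generated graded module `M = ⨁_j ℳ j` over the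
standard graded polynomial ring `S = k[x_v : v ∈ V]`: the maximum of `j - i` over all `i`, `j` for
which the free module `F_i` of the minimal graded free resolution of `M` has a summand `S(-j)`,
that is, `β_{i,j}(M) ≠ 0`. (The minimal graded free resolution is unique up to isomorphism, so
taking all of them into account does not change the supremum; the value is `⊥` for `M = 0`.) -/
noncomputable def regularity {k : Type*} [Field k] (V : Type*) {M : Type*}
    [AddCommGroup M] [Module (MvPolynomial V k) M] [Module k M]
    (ℳ : ℤ → Submodule k M) : WithBot (WithTop ℤ) :=
  ⨆ (F : MinimalGradedFreeResolution (V := V) ℳ) (i : ℕ) (a : Fin (F.rank i)),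
    (((F.shift i a - (i : ℤ) : ℤ) : WithTop ℤ) : WithBot (WithTop ℤ))

/-! The residues modulo 6 encode two simple formulas: the regularity is `2⌊n/3⌋`, plus `1` if `n ≡ 2
mod 3`, and the projective dimension is `⌈n/3⌉`. Both come from building the ideal one monomial
generator at a time.

Let `x` be a variable and `μ` a monomial with `(I : xμ) = (I : μ) = J`. Multiplication by `xμ` gives
an exact sequence `0 → S/J → S/I → S/(I + (xμ)) → 0` (up to a shift). Its chain map can be taken to
be `x` times a lift of multiplication by `μ`, so its entries lie in the ideal of the variables and
the mapping cone is again minimal. Hence the new regularity is `max (reg S/I) (reg S/J + deg μ)` and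
the new projective dimension is `max (pd S/I) (pd S/J + 1)` (`HasInvariants.sup_span_mul`, and
`SupportInvariants.or_subset` in combinatorial form).

Number the vertices from `0` and let `I_u` be generated by the neighborhoods of the vertices `w <
u`, where `u + 2 ≤ n`, so that none is cut off on the right. For `u ≥ 3`, passing to `I_{u+1}` adds
the interval `[u-2, u+2]`; the colon ideal is `I_{u-5} + (x_{u-3})`, and `x_{u+2}` is the new
variable. This settles `I_u`. The closed neighborhood ideal of `P_{m+3}^2` is `I_m + (x_m x_{m+1}
x_{m+2})`, and the colon ideal by the last generator is the closed neighborhood ideal of `P_m^2`. So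
three more vertices add 2 to the regularity and 1 to the projective dimension.

Any minimal resolution determines both invariants (`exists_shift_eq`,
`not_hasProjectiveDimensionLT`). -/

open MvPolynomial

/-! ### Homogeneous components of polynomials, vectors and linear maps. -/

section Homogeneous

variable {k : Type*} [Field k] {V : Type*}

/-- `f` is homogeneous of degree `j : ℤ` for the standard grading. -/
abbrev IsHom (f : MvPolynomial V k) (j : ℤ) : Prop :=
  IsWeightedHomogeneous (fun _ : V => (1 : ℤ)) f j

/-- The homogeneous component of degree `j : ℤ` for the standard grading. -/
noncomputable abbrev homPart (j : ℤ) : MvPolynomial V k →ₗ[k] MvPolynomial V k :=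
  weightedHomogeneousComponent (fun _ : V => (1 : ℤ)) j

theorem homPart_of_isHom {f : MvPolynomial V k} {i : ℤ} (hf : IsHom f i) (j : ℤ) :
    homPart j f = if j = i then f else 0 := by
  split_ifs with h
  · subst h; exact hf.weightedHomogeneousComponent_same
  · exact hf.weightedHomogeneousComponent_ne _ (fun h' => h h')

theorem isHom_monomial (s : V →₀ ℕ) (c : k) :
    IsHom (monomial s c) (Finsupp.weight (fun _ : V => (1 : ℤ)) s) :=
  isWeightedHomogeneous_monomial _ _ _ rfl

theorem homPart_mul {f g : MvPolynomial V k} {i : ℤ} (hg : IsHom g i) (j : ℤ) :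
    homPart (j + i) (f * g) = homPart j f * g := by
  classical
  induction f using MvPolynomial.induction_on' with
  | monomial a b =>
    have h := isHom_monomial (k := k) a b
    rw [homPart_of_isHom h, homPart_of_isHom (h.mul hg)]
    simp only [add_left_inj]
    split_ifs <;> simp
  | add f₁ f₂ h₁ h₂ => rw [add_mul, map_add, map_add, h₁, h₂, add_mul]

/-- A vector in `⨁ S(-σ a)` is homogeneous of degree `j`. -/
def IsHomVec {ι : Type*} (σ : ι → ℤ) (j : ℤ) (z : ι → MvPolynomial V k) : Prop :=
  ∀ a, IsHom (z a) (j - σ a)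

/-- The homogeneous component of degree `j` of a vector in `⨁ S(-σ a)`. -/
noncomputable def homVec {ι : Type*} (σ : ι → ℤ) (j : ℤ) (z : ι → MvPolynomial V k) :
    ι → MvPolynomial V k := fun a => homPart (j - σ a) (z a)

theorem isHomVec_homVec {ι : Type*} (σ : ι → ℤ) (j : ℤ) (z : ι → MvPolynomial V k) :
    IsHomVec σ j (homVec σ j z) :=
  fun _ => weightedHomogeneousComponent_isWeightedHomogeneous _ _

theorem IsHomVec.homVec_eq {ι : Type*} {σ : ι → ℤ} {j : ℤ} {z : ι → MvPolynomial V k}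
    (h : IsHomVec σ j z) : homVec σ j z = z :=
  funext fun a => (h a).weightedHomogeneousComponent_same

/-- A linear map `⨁ S(-σ a) → ⨁ S(-τ b)` is homogeneous of degree `e`. -/
def IsHomMap {ι κ : Type*} [DecidableEq ι] (σ : ι → ℤ) (τ : κ → ℤ) (e : ℤ)
    (φ : (ι → MvPolynomial V k) →ₗ[MvPolynomial V k] (κ → MvPolynomial V k)) : Prop :=
  ∀ b, IsHomVec τ (σ b + e) (φ (Pi.single b 1))

variable {ι κ : Type*} [Fintype ι] [DecidableEq ι] {σ : ι → ℤ} {τ : κ → ℤ} {e : ℤ}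
  {φ : (ι → MvPolynomial V k) →ₗ[MvPolynomial V k] (κ → MvPolynomial V k)}

theorem linearMap_apply_eq_sum {R M : Type*} [CommRing R] [AddCommGroup M] [Module R M]
    (φ : (ι → R) →ₗ[R] M) (z : ι → R) : φ z = ∑ b, z b • φ (Pi.single b 1) := by
  conv_lhs => rw [pi_eq_sum_univ' z]
  simp

theorem IsHomMap.homVec_map (h : IsHomMap σ τ e φ) (j : ℤ) (z : ι → MvPolynomial V k) :
    homVec τ (j + e) (φ z) = φ (homVec σ j z) := by
  funext a
  rw [linearMap_apply_eq_sum φ z, linearMap_apply_eq_sum φ (homVec σ j z)]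
  simp only [homVec, Finset.sum_apply, Pi.smul_apply, smul_eq_mul, map_sum]
  refine Finset.sum_congr rfl fun b _ => ?_
  rw [← homPart_mul (h b a)]
  congr 2
  ring

theorem IsHomMap.isHomVec (h : IsHomMap σ τ e φ) {j : ℤ} {z : ι → MvPolynomial V k}
    (hz : IsHomVec σ j z) : IsHomVec τ (j + e) (φ z) := by
  rw [← hz.homVec_eq, ← h.homVec_map]
  exact isHomVec_homVec _ _ _

end Homogeneous

/-- The properties of a grading used for resolutions: it is compatible with the scalar
multiplication, and it is independent. -/
structure IsGradedFamily {k : Type*} [Field k] {V : Type*} {M : Type*}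
    [AddCommGroup M] [Module (MvPolynomial V k) M] [Module k M]
    (ℳ : ℤ → Submodule k M) : Prop where
  smul_mem : ∀ {f : MvPolynomial V k} {i j : ℤ} {m : M}, IsHom f i → m ∈ ℳ j → f • m ∈ ℳ (i + j)
  exists_proj : ∃ π : ℤ → M →+ M, ∀ (i j : ℤ) (m : M), m ∈ ℳ i → π j m = if j = i then m else 0

section Augmentation

variable {k : Type*} [Field k] {V : Type*} {M : Type*}
    [AddCommGroup M] [Module (MvPolynomial V k) M] [Module k M]
    {ℳ : ℤ → Submodule k M} {ι : Type*} [Fintype ι] [DecidableEq ι] {σ : ι → ℤ}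
    {ε : (ι → MvPolynomial V k) →ₗ[MvPolynomial V k] M}

/-- The projection `π j` recovers the degree `j` part of `ε z`, and on each `z b • ε (e_b)` it
selects the matching component of `z b`. No full direct sum decomposition of `M` is needed. -/
theorem IsGradedFamily.map_homVec (hℳ : IsGradedFamily (V := V) ℳ)
    (hε : ∀ b, ε (Pi.single b 1) ∈ ℳ (σ b)) {j : ℤ} {z : ι → MvPolynomial V k}
    (hz : ε z ∈ ℳ j) : ε (homVec σ j z) = ε z := by
  obtain ⟨π, hπ⟩ := hℳ.exists_proj
  have key : ∀ (f : MvPolynomial V k) (i : ℤ) (m : M), m ∈ ℳ i →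
      π j (f • m) = homPart (j - i) f • m := by
    intro f i m hm
    induction f using MvPolynomial.induction_on' with
    | monomial a c =>
      have h := isHom_monomial (k := k) a c
      rw [hπ _ j _ (hℳ.smul_mem h hm), homPart_of_isHom h]
      simp only [sub_eq_iff_eq_add]
      split_ifs <;> simp
    | add f₁ f₂ h₁ h₂ => rw [add_smul, map_add, h₁, h₂, map_add, add_smul]
  have h1 : π j (ε z) = ε z := by simpa using hπ j j _ hz
  rw [← h1, linearMap_apply_eq_sum ε z, linearMap_apply_eq_sum ε (homVec σ j z), map_sum]
  exact Finset.sum_congr rfl fun b _ => (key _ _ _ (hε b)).symm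

end Augmentation

/-! ### Graded resolutions and the comparison theorem. -/

/-- Minimal graded free resolutions whose bases are indexed by arbitrary finite types. -/
structure GradedResolution {k : Type*} [Field k] {V : Type*} {M : Type*}
    [AddCommGroup M] [Module (MvPolynomial V k) M] [Module k M]
    (ℳ : ℤ → Submodule k M) where
  ι : ℕ → Type
  [fintype : ∀ i, Fintype (ι i)]
  [decEq : ∀ i, DecidableEq (ι i)]
  shift : (i : ℕ) → ι i → ℤ
  d : (i : ℕ) →
    (ι (i + 1) → MvPolynomial V k) →ₗ[MvPolynomial V k] (ι i → MvPolynomial V k)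
  ε : (ι 0 → MvPolynomial V k) →ₗ[MvPolynomial V k] M
  d_homogeneous : ∀ i, IsHomMap (shift (i + 1)) (shift i) 0 (d i)
  ε_homogeneous : ∀ b, ε (Pi.single b 1) ∈ ℳ (shift 0 b)
  ε_surjective : Function.Surjective ε
  exact_zero : Function.Exact (d 0) ε
  exact_succ : ∀ i : ℕ, Function.Exact (d (i + 1)) (d i)
  minimal : ∀ i b a,
    d i (Pi.single b 1) a ∈ Ideal.span (Set.range (X : V → MvPolynomial V k))

attribute [instance] GradedResolution.fintype GradedResolution.decEq

namespace GradedResolution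

section Comparison

variable {k : Type*} [Field k] {V : Type*} {M N : Type*}
    [AddCommGroup M] [Module (MvPolynomial V k) M] [Module k M]
    [AddCommGroup N] [Module (MvPolynomial V k) N] [Module k N]
    {ℳ : ℤ → Submodule k M} {𝒩 : ℤ → Submodule k N}

/-- The kernel of the map leaving the `i`-th module of a resolution. -/
noncomputable def cycles (F : GradedResolution (V := V) ℳ) :
    (i : ℕ) → Submodule (MvPolynomial V k) (F.ι i → MvPolynomial V k)
  | 0 => LinearMap.ker F.ε
  | i + 1 => LinearMap.ker (F.d i)

theorem range_d (F : GradedResolution (V := V) ℳ) (i : ℕ) :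
    LinearMap.range (F.d i) = F.cycles i := by
  cases i with
  | zero => exact (LinearMap.exact_iff.1 F.exact_zero).symm
  | succ i => exact (LinearMap.exact_iff.1 (F.exact_succ i)).symm

theorem exists_d_eq (F : GradedResolution (V := V) ℳ) {i : ℕ} {z : F.ι i → MvPolynomial V k}
    (hz : z ∈ F.cycles i) : ∃ y, F.d i y = z := by
  rwa [← range_d] at hz

theorem d_mem_cycles (F : GradedResolution (V := V) ℳ) (i : ℕ) (z) : F.d i z ∈ F.cycles i := by
  rw [← range_d]; exact ⟨z, rfl⟩

@[simp] theorem d_d (F : GradedResolution (V := V) ℳ) (i : ℕ) (z) : F.d i (F.d (i + 1) z) = 0 :=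
  F.d_mem_cycles (i + 1) z

/-- Exactness lifts each basis vector separately; keeping only the component of the right degree of
a lift leaves it a lift, since its target is homogeneous. Preservation of cycles is carried along so
that the construction can be iterated. -/
theorem exists_lift_succ (F : GradedResolution (V := V) ℳ) (G : GradedResolution (V := V) 𝒩)
    {e : ℤ} {i : ℕ}
    (φ : (F.ι i → MvPolynomial V k) →ₗ[MvPolynomial V k] (G.ι i → MvPolynomial V k))
    (hφ : IsHomMap (F.shift i) (G.shift i) e φ) (hc : ∀ z ∈ F.cycles i, φ z ∈ G.cycles i) :
    ∃ ψ : (F.ι (i + 1) → MvPolynomial V k) →ₗ[MvPolynomial V k] (G.ι (i + 1) → MvPolynomial V k),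
      (IsHomMap (F.shift (i + 1)) (G.shift (i + 1)) e ψ ∧
        ∀ z ∈ F.cycles (i + 1), ψ z ∈ G.cycles (i + 1)) ∧ ∀ z, G.d i (ψ z) = φ (F.d i z) := by
  have h : ∀ b : F.ι (i + 1), ∃ y, G.d i y = φ (F.d i (Pi.single b 1)) ∧
      IsHomVec (G.shift (i + 1)) (F.shift (i + 1) b + e) y := by
    intro b
    obtain ⟨y, hy⟩ := G.exists_d_eq (hc _ (F.d_mem_cycles i (Pi.single b 1)))
    refine ⟨homVec (G.shift (i + 1)) (F.shift (i + 1) b + e) y, ?_, isHomVec_homVec _ _ _⟩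
    rw [← (G.d_homogeneous i).homVec_map, hy]
    refine IsHomVec.homVec_eq ?_
    simpa using hφ.isHomVec (F.d_homogeneous i b)
  choose y hy hy' using h
  have hcomm : ∀ z, G.d i ((Pi.basisFun _ _).constr (MvPolynomial V k) y z) = φ (F.d i z) := by
    intro z
    have : G.d i ∘ₗ (Pi.basisFun _ _).constr (MvPolynomial V k) y = φ ∘ₗ F.d i := by
      refine (Pi.basisFun _ _).ext fun b => ?_
      rw [LinearMap.comp_apply, Module.Basis.constr_basis, hy, Pi.basisFun_apply]
      rfl
    exact LinearMap.congr_fun this z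
  refine ⟨(Pi.basisFun _ _).constr (MvPolynomial V k) y, ⟨fun b => ?_, fun z hz => ?_⟩, hcomm⟩
  · rw [← Pi.basisFun_apply, Module.Basis.constr_basis]
    exact hy' b
  · have hz' : F.d i z = 0 := hz
    change G.d i _ = 0
    rw [hcomm, hz', map_zero]

theorem exists_lift_zero (F : GradedResolution (V := V) ℳ) (G : GradedResolution (V := V) 𝒩)
    (h𝒩 : IsGradedFamily (V := V) 𝒩) {e : ℤ} (f : M →ₗ[MvPolynomial V k] N)
    (hf : ∀ j, ∀ m ∈ ℳ j, f m ∈ 𝒩 (j + e)) :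
    ∃ ψ : (F.ι 0 → MvPolynomial V k) →ₗ[MvPolynomial V k] (G.ι 0 → MvPolynomial V k),
      (IsHomMap (F.shift 0) (G.shift 0) e ψ ∧
        ∀ z ∈ F.cycles 0, ψ z ∈ G.cycles 0) ∧ ∀ z, G.ε (ψ z) = f (F.ε z) := by
  have h : ∀ b : F.ι 0, ∃ y, G.ε y = f (F.ε (Pi.single b 1)) ∧
      IsHomVec (G.shift 0) (F.shift 0 b + e) y := by
    intro b
    obtain ⟨y, hy⟩ := G.ε_surjective (f (F.ε (Pi.single b 1)))
    refine ⟨homVec (G.shift 0) (F.shift 0 b + e) y, ?_, isHomVec_homVec _ _ _⟩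
    rw [h𝒩.map_homVec G.ε_homogeneous, hy]
    rw [hy]
    exact hf _ _ (F.ε_homogeneous b)
  choose y hy hy' using h
  have hcomm : ∀ z, G.ε ((Pi.basisFun _ _).constr (MvPolynomial V k) y z) = f (F.ε z) := by
    intro z
    have : G.ε ∘ₗ (Pi.basisFun _ _).constr (MvPolynomial V k) y = f ∘ₗ F.ε := by
      refine (Pi.basisFun _ _).ext fun b => ?_
      rw [LinearMap.comp_apply, Module.Basis.constr_basis, hy, Pi.basisFun_apply]
      rfl
    exact LinearMap.congr_fun this z
  refine ⟨(Pi.basisFun _ _).constr (MvPolynomial V k) y, ⟨fun b => ?_, fun z hz => ?_⟩, hcomm⟩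
  · rw [← Pi.basisFun_apply, Module.Basis.constr_basis]
    exact hy' b
  · have hz' : F.ε z = 0 := hz
    change G.ε _ = 0
    rw [hcomm, hz', map_zero]

/-- The comparison theorem for graded free resolutions. -/
theorem exists_lift (F : GradedResolution (V := V) ℳ) (G : GradedResolution (V := V) 𝒩)
    (h𝒩 : IsGradedFamily (V := V) 𝒩) {e : ℤ} (f : M →ₗ[MvPolynomial V k] N)
    (hf : ∀ j, ∀ m ∈ ℳ j, f m ∈ 𝒩 (j + e)) :
    ∃ ψ : (i : ℕ) →
        (F.ι i → MvPolynomial V k) →ₗ[MvPolynomial V k] (G.ι i → MvPolynomial V k),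
      (∀ i, IsHomMap (F.shift i) (G.shift i) e (ψ i)) ∧ (∀ z, G.ε (ψ 0 z) = f (F.ε z)) ∧
        ∀ i z, G.d i (ψ (i + 1) z) = ψ i (F.d i z) := by
  obtain ⟨ψ₀, h₀, h₀'⟩ := F.exists_lift_zero G h𝒩 f hf
  have step := fun i φ hφ => F.exists_lift_succ G (e := e) (i := i) φ (And.left hφ) (And.right hφ)
  choose s hs hs' using step
  let Ψ : (i : ℕ) → {φ : (F.ι i → MvPolynomial V k) →ₗ[MvPolynomial V k]
      (G.ι i → MvPolynomial V k) // IsHomMap (F.shift i) (G.shift i) e φ ∧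
        ∀ z ∈ F.cycles i, φ z ∈ G.cycles i} :=
    fun i => Nat.rec ⟨ψ₀, h₀⟩ (fun i φ => ⟨s i φ.1 φ.2, hs i φ.1 φ.2⟩) i
  exact ⟨fun i => (Ψ i).1, fun i => (Ψ i).2.1, h₀', fun i z => hs' i _ _ z⟩

end Comparison

end GradedResolution

/-! ### Minimality and uniqueness of the shifts. -/

section Irrelevant

variable (k : Type*) [Field k] (V : Type*)

/-- The ideal generated by the variables. -/
noncomputable abbrev irrelevantIdeal : Ideal (MvPolynomial V k) := Ideal.span (Set.range X)

variable {k V}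

theorem mem_irrelevantIdeal {f : MvPolynomial V k} :
    f ∈ irrelevantIdeal k V ↔ constantCoeff f = 0 := by
  rw [irrelevantIdeal, ← Set.image_univ, mem_ideal_span_X_image, constantCoeff_eq]
  constructor
  · intro h
    by_contra h0
    obtain ⟨i, -, hi⟩ := h 0 (mem_support_iff.2 h0)
    exact hi rfl
  · intro h m hm
    by_contra! hc
    have : m = 0 := Finsupp.ext fun i => hc i trivial
    exact mem_support_iff.1 hm (this ▸ h)

theorem one_notMem_irrelevantIdeal : (1 : MvPolynomial V k) ∉ irrelevantIdeal k V := by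
  simp [mem_irrelevantIdeal]

theorem IsHom.eq_zero_of_notMem {f : MvPolynomial V k} {j : ℤ} (hf : IsHom f j)
    (h : f ∉ irrelevantIdeal k V) : j = 0 := by
  rw [mem_irrelevantIdeal, constantCoeff_eq] at h
  simpa using (hf h).symm

theorem map_apply_mem_ideal {R ι κ : Type*} [CommRing R] [Fintype ι] [DecidableEq ι] {I : Ideal R}
    (φ : (ι → R) →ₗ[R] (κ → R)) {z : ι → R} (h : ∀ b, z b ∈ I ∨ ∀ a, φ (Pi.single b 1) a ∈ I)
    (a : κ) : φ z a ∈ I := by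
  rw [linearMap_apply_eq_sum, Finset.sum_apply]
  refine Submodule.sum_mem _ fun b _ => ?_
  rcases h b with h | h
  · exact Ideal.mul_mem_right _ _ h
  · exact Ideal.mul_mem_left _ _ (h a)

theorem exact_conj {R A B C A' B' C' : Type*} [CommRing R] [AddCommGroup A] [AddCommGroup B]
    [AddCommGroup C] [AddCommGroup A'] [AddCommGroup B'] [AddCommGroup C']
    [Module R A] [Module R B] [Module R C] [Module R A'] [Module R B'] [Module R C']
    (a : A ≃ₗ[R] A') (b : B ≃ₗ[R] B') (c : C ≃ₗ[R] C') {f : A →ₗ[R] B} {g : B →ₗ[R] C}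
    (h : Function.Exact f g) :
    Function.Exact (b.toLinearMap ∘ₗ f ∘ₗ a.symm.toLinearMap)
      (c.toLinearMap ∘ₗ g ∘ₗ b.symm.toLinearMap) := by
  intro y
  have := h (b.symm y)
  simp only [LinearMap.comp_apply, LinearEquiv.coe_coe, Set.mem_range,
    LinearEquiv.map_eq_zero_iff, this]
  exact ⟨fun ⟨x, hx⟩ => ⟨a x, by simp [hx]⟩, fun ⟨x, hx⟩ => ⟨a.symm x, by simp [← hx]⟩⟩

end Irrelevant

namespace GradedResolution

variable {k : Type*} [Field k] {V : Type*} {M N : Type*}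
    [AddCommGroup M] [Module (MvPolynomial V k) M] [Module k M]
    [AddCommGroup N] [Module (MvPolynomial V k) N] [Module k N]
    {ℳ : ℤ → Submodule k M} {𝒩 : ℤ → Submodule k N}

theorem d_apply_mem (F : GradedResolution (V := V) ℳ) (i : ℕ) (z : F.ι (i + 1) → MvPolynomial V k)
    (a : F.ι i) : F.d i z a ∈ irrelevantIdeal k V :=
  map_apply_mem_ideal _ (fun b => Or.inr (F.minimal i b)) a

/-- A chain map lifting zero is null-homotopic. -/
theorem exists_homotopy (F : GradedResolution (V := V) ℳ)
    (χ : (i : ℕ) → (F.ι i → MvPolynomial V k) →ₗ[MvPolynomial V k] (F.ι i → MvPolynomial V k))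
    (h₀ : ∀ z, F.ε (χ 0 z) = 0) (hχ : ∀ i z, F.d i (χ (i + 1) z) = χ i (F.d i z)) (i : ℕ) :
    ∃ h : (F.ι i → MvPolynomial V k) →ₗ[MvPolynomial V k] (F.ι (i + 1) → MvPolynomial V k),
      (∀ z, χ i (F.d i z) = F.d i (h (F.d i z))) ∧ ∀ z a, χ i z a ∈ irrelevantIdeal k V := by
  have lift : ∀ {i : ℕ}
      (α : (F.ι i → MvPolynomial V k) →ₗ[MvPolynomial V k] (F.ι i → MvPolynomial V k)),
      (∀ z, α z ∈ F.cycles i) → ∃ h : (F.ι i → MvPolynomial V k) →ₗ[MvPolynomial V k]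
        (F.ι (i + 1) → MvPolynomial V k), ∀ z, F.d i (h z) = α z := by
    intro i α hα
    choose y hy using fun b => F.exists_d_eq (hα (Pi.single b 1))
    refine ⟨(Pi.basisFun _ _).constr (MvPolynomial V k) y, fun z => ?_⟩
    have : F.d i ∘ₗ (Pi.basisFun _ _).constr (MvPolynomial V k) y = α := by
      refine (Pi.basisFun _ _).ext fun b => ?_
      rw [LinearMap.comp_apply, Module.Basis.constr_basis, hy, Pi.basisFun_apply]
    exact LinearMap.congr_fun this z
  -- A homotopy satisfies `χ_i = d_i h_i + h_{i-1} d_{i-1}`. On boundaries the last term vanishes,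
  -- which leaves an identity of the same form for `i = 0` and `i > 0`; it is all that the next step
  -- uses.
  induction i with
  | zero =>
    obtain ⟨h, hh⟩ := lift (χ 0) h₀
    exact ⟨h, fun z => (hh _).symm, fun z a => hh z ▸ F.d_apply_mem _ _ _⟩
  | succ i ih =>
    obtain ⟨h, hh, -⟩ := ih
    obtain ⟨h', hh'⟩ := lift (χ (i + 1) - h ∘ₗ F.d i) (fun z => by
      change F.d i _ = 0
      rw [LinearMap.sub_apply, map_sub, hχ, hh, LinearMap.comp_apply, sub_self])
    refine ⟨h', fun z => ?_, fun z a => ?_⟩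
    · rw [hh', LinearMap.sub_apply, LinearMap.comp_apply, d_d, map_zero, sub_zero]
    · have : χ (i + 1) z = F.d (i + 1) (h' z) + h (F.d i z) := by rw [hh']; simp
      rw [this]
      exact Ideal.add_mem _ (F.d_apply_mem _ _ _)
        (map_apply_mem_ideal _ (fun b => Or.inl (F.d_apply_mem _ _ _)) _)

/-- The degrees of the basis vectors do not depend on the minimal resolution. -/
theorem exists_shift_eq (F G : GradedResolution (V := V) ℳ) (hℳ : IsGradedFamily (V := V) ℳ)
    (i : ℕ) (a : F.ι i) : ∃ b, G.shift i b = F.shift i a := by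
  obtain ⟨φ, hφ, hφ₀, hφ'⟩ := F.exists_lift G hℳ (e := 0) LinearMap.id (by simp)
  obtain ⟨ψ, hψ, hψ₀, hψ'⟩ := G.exists_lift F hℳ (e := 0) LinearMap.id (by simp)
  obtain ⟨-, -, hχ⟩ := F.exists_homotopy (fun i => ψ i ∘ₗ φ i - LinearMap.id)
    (by simp [hψ₀, hφ₀]) (by simp [hψ', hφ']) i
  -- Modulo the variables `ψ φ` is the identity, so its diagonal entry at `a` is a unit there. Some
  -- entry of `φ` in column `a` thus has nonzero constant term, and homogeneity makes its degree,
  -- the difference of two shifts, zero.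
  have h1 : ψ i (φ i (Pi.single a 1)) a ∉ irrelevantIdeal k V := fun h => by
    have := sub_mem h (hχ (Pi.single a 1) a)
    simp [mem_irrelevantIdeal] at this
  have h2 : ∃ b, φ i (Pi.single a 1) b ∉ irrelevantIdeal k V := by
    by_contra! h
    exact h1 (map_apply_mem_ideal _ (fun b => Or.inl (h b)) a)
  obtain ⟨b, hb⟩ := h2
  have := IsHom.eq_zero_of_notMem (hφ i a b) hb
  exact ⟨b, by omega⟩

/-- The bases of a `MinimalGradedFreeResolution` are indexed by finite types. -/
noncomputable def ofMinimal (F : MinimalGradedFreeResolution (V := V) ℳ) :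
    GradedResolution (V := V) ℳ where
  ι i := Fin (F.rank i)
  shift := F.shift
  d := F.d
  ε := F.ε
  d_homogeneous i b a := by simpa using F.d_homogeneous i b a
  ε_homogeneous := F.ε_homogeneous
  ε_surjective := F.ε_surjective
  exact_zero := F.exact_zero
  exact_succ := F.exact_succ
  minimal := F.minimal

/-- Enumerating the bases gives a `MinimalGradedFreeResolution`. -/
noncomputable def toMinimal (F : GradedResolution (V := V) ℳ) :
    MinimalGradedFreeResolution (V := V) ℳ :=
  let L (i : ℕ) : (F.ι i → MvPolynomial V k) ≃ₗ[MvPolynomial V k]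
    (Fin (Fintype.card (F.ι i)) → MvPolynomial V k) :=
    LinearEquiv.funCongrLeft _ _ (Fintype.equivFin (F.ι i)).symm
  have hL (i : ℕ) (b) : (L i).symm (Pi.single b 1) =
      Pi.single ((Fintype.equivFin (F.ι i)).symm b) 1 := by
    funext a
    change Pi.single b 1 (Fintype.equivFin (F.ι i) a) = _
    by_cases h : a = (Fintype.equivFin (F.ι i)).symm b
    · subst h; simp
    · rw [Pi.single_eq_of_ne h, Pi.single_eq_of_ne]
      rintro rfl; simp at h
  { rank := fun i => Fintype.card (F.ι i)
    shift := fun i b => F.shift i ((Fintype.equivFin (F.ι i)).symm b)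
    d := fun i => (L i).toLinearMap ∘ₗ F.d i ∘ₗ (L (i + 1)).symm.toLinearMap
    ε := F.ε ∘ₗ (L 0).symm.toLinearMap
    d_homogeneous := fun i b a => by
      simp only [LinearMap.comp_apply, LinearEquiv.coe_coe, hL]
      have := F.d_homogeneous i ((Fintype.equivFin _).symm b) ((Fintype.equivFin _).symm a)
      rwa [add_zero] at this
    ε_homogeneous := fun b => by
      simp only [LinearMap.comp_apply, LinearEquiv.coe_coe, hL]
      exact F.ε_homogeneous _
    ε_surjective := F.ε_surjective.comp (L 0).symm.surjective
    exact_zero := exact_conj (L 1) (L 0) (LinearEquiv.refl _ _) F.exact_zero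
    exact_succ := fun i => exact_conj (L (i + 2)) (L (i + 1)) (L i) (F.exact_succ i)
    minimal := fun i b a => by
      simp only [LinearMap.comp_apply, LinearEquiv.coe_coe, hL]
      exact F.minimal i _ _ }

/-- All minimal resolutions have the same shifts, so the supremum over all of them can be computed
on one. -/
theorem regularity_eq (F : GradedResolution (V := V) ℳ) (hℳ : IsGradedFamily (V := V) ℳ) {r : ℤ}
    (hle : ∀ i a, F.shift i a ≤ r + i) (heq : ∃ i a, F.shift i a = r + i) :
    regularity V ℳ = ((r : WithTop ℤ) : WithBot (WithTop ℤ)) := by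
  refine le_antisymm ?_ ?_
  · refine iSup_le fun G => iSup_le fun i => iSup_le fun a => ?_
    obtain ⟨b, hb⟩ := (ofMinimal G).exists_shift_eq F hℳ i a
    have := hle i b
    have hb' : F.shift i b = G.shift i a := hb
    exact_mod_cast (by omega : G.shift i a - (i : ℤ) ≤ r)
  · obtain ⟨i, a, h⟩ := heq
    refine le_iSup_of_le F.toMinimal (le_iSup_of_le i
      (le_iSup_of_le (Fintype.equivFin (F.ι i) a) ?_))
    have : F.toMinimal.shift i (Fintype.equivFin (F.ι i) a) = r + i := by
      simp [toMinimal, h]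
    rw [this]
    simp

end GradedResolution

/-! ### The mapping cone as a minimal resolution. -/

theorem single_inl {α β R : Type*} [DecidableEq α] [DecidableEq β] [Semiring R] (a : α) :
    (Pi.single (Sum.inl a) 1 : α ⊕ β → R) = Sum.elim (Pi.single a 1) (fun _ => 0) := by
  funext b; cases b <;> simp [Pi.single_apply]

theorem single_inr {α β R : Type*} [DecidableEq α] [DecidableEq β] [Semiring R] (b : β) :
    (Pi.single (Sum.inr b) 1 : α ⊕ β → R) = Sum.elim (fun _ => 0) (Pi.single b 1) := by
  funext b; cases b <;> simp [Pi.single_apply]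

namespace GradedResolution

section Cone

variable {k : Type*} [Field k] {V : Type*} {M N Q : Type*}
    [AddCommGroup M] [Module (MvPolynomial V k) M] [Module k M]
    [AddCommGroup N] [Module (MvPolynomial V k) N] [Module k N]
    [AddCommGroup Q] [Module (MvPolynomial V k) Q]
    {ℳ : ℤ → Submodule k M} {𝒩 : ℤ → Submodule k N}

variable (F : GradedResolution (V := V) ℳ) (G : GradedResolution (V := V) 𝒩)
  (ψ : (i : ℕ) → (G.ι i → MvPolynomial V k) →ₗ[MvPolynomial V k] (F.ι i → MvPolynomial V k))

/-- The first differential of the mapping cone of `ψ`. -/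
noncomputable def coneDZero : (F.ι 1 ⊕ G.ι 0 → MvPolynomial V k) →ₗ[MvPolynomial V k]
    (F.ι 0 → MvPolynomial V k) :=
  F.d 0 ∘ₗ LinearMap.funLeft _ _ Sum.inl + ψ 0 ∘ₗ LinearMap.funLeft _ _ Sum.inr

/-- The later differentials of the mapping cone of `ψ`. -/
noncomputable def coneDSucc (i : ℕ) :
    (F.ι (i + 2) ⊕ G.ι (i + 1) → MvPolynomial V k) →ₗ[MvPolynomial V k]
      (F.ι (i + 1) ⊕ G.ι i → MvPolynomial V k) :=
  (LinearEquiv.sumArrowLequivProdArrow _ _ _ _).symm.toLinearMap ∘ₗ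
    (F.d (i + 1) ∘ₗ LinearMap.funLeft _ _ Sum.inl +
      ψ (i + 1) ∘ₗ LinearMap.funLeft _ _ Sum.inr).prod
    (-G.d i ∘ₗ LinearMap.funLeft _ _ Sum.inr)

theorem coneDZero_elim (f g) : coneDZero F G ψ (Sum.elim f g) = F.d 0 f + ψ 0 g := rfl

theorem coneDSucc_elim (i : ℕ) (f g) : coneDSucc F G ψ i (Sum.elim f g) =
    Sum.elim (F.d (i + 1) f + ψ (i + 1) g) (-G.d i g) := rfl

theorem coneDZero_inl (b) : coneDZero F G ψ (Pi.single (Sum.inl b) 1) =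
    F.d 0 (Pi.single b 1) := by
  rw [single_inl, coneDZero_elim, show (fun _ : G.ι 0 => (0 : MvPolynomial V k)) = 0 from rfl,
    map_zero, add_zero]

theorem coneDZero_inr (b) : coneDZero F G ψ (Pi.single (Sum.inr b) 1) =
    ψ 0 (Pi.single b 1) := by
  rw [single_inr, coneDZero_elim, show (fun _ : F.ι 1 => (0 : MvPolynomial V k)) = 0 from rfl,
    map_zero, zero_add]

theorem coneDSucc_inl (i : ℕ) (b) : coneDSucc F G ψ i (Pi.single (Sum.inl b) 1) =
    Sum.elim (F.d (i + 1) (Pi.single b 1)) 0 := by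
  rw [single_inl, coneDSucc_elim,
    show (fun _ : G.ι (i + 1) => (0 : MvPolynomial V k)) = 0 from rfl,
    map_zero, add_zero, map_zero, neg_zero]

theorem coneDSucc_inr (i : ℕ) (b) : coneDSucc F G ψ i (Pi.single (Sum.inr b) 1) =
    Sum.elim (ψ (i + 1) (Pi.single b 1)) (-G.d i (Pi.single b 1)) := by
  rw [single_inr, coneDSucc_elim,
    show (fun _ : F.ι (i + 2) => (0 : MvPolynomial V k)) = 0 from rfl, map_zero, zero_add]

variable {F G ψ}

theorem isHomMap_coneDZero {e : ℤ} (hψ : ∀ i, IsHomMap (G.shift i) (F.shift i) e (ψ i)) :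
    IsHomMap (Sum.elim (F.shift 1) (fun b => G.shift 0 b + e)) (F.shift 0) 0
      (coneDZero F G ψ) := by
  rintro (b | b) a
  · rw [coneDZero_inl]
    exact F.d_homogeneous 0 b a
  · rw [coneDZero_inr, Sum.elim_inr, add_zero]
    exact hψ 0 b a

theorem isHomMap_coneDSucc {e : ℤ} (hψ : ∀ i, IsHomMap (G.shift i) (F.shift i) e (ψ i)) (i : ℕ) :
    IsHomMap (Sum.elim (F.shift (i + 2)) (fun b => G.shift (i + 1) b + e))
      (Sum.elim (F.shift (i + 1)) (fun b => G.shift i b + e)) 0 (coneDSucc F G ψ i) := by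
  rintro (b | b) (a | a)
  · rw [coneDSucc_inl]
    exact F.d_homogeneous (i + 1) b a
  · rw [coneDSucc_inl]
    exact isWeightedHomogeneous_zero _ _ _
  · rw [coneDSucc_inr, Sum.elim_inr, add_zero]
    exact hψ (i + 1) b a
  · rw [coneDSucc_inr, Sum.elim_inr, Sum.elim_inr, Sum.elim_inr]
    have := (G.d_homogeneous i b a).neg
    rwa [show G.shift (i + 1) b + 0 - G.shift i a =
      G.shift (i + 1) b + e + 0 - (G.shift i a + e) by ring] at this

theorem coneDZero_apply_mem (hmin : ∀ i b a, ψ i (Pi.single b 1) a ∈ irrelevantIdeal k V) (b a) :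
    coneDZero F G ψ (Pi.single b 1) a ∈ irrelevantIdeal k V := by
  rcases b with b | b
  · rw [coneDZero_inl]
    exact F.minimal 0 b a
  · rw [coneDZero_inr]
    exact hmin 0 b a

theorem coneDSucc_apply_mem (hmin : ∀ i b a, ψ i (Pi.single b 1) a ∈ irrelevantIdeal k V)
    (i : ℕ) (b a) : coneDSucc F G ψ i (Pi.single b 1) a ∈ irrelevantIdeal k V := by
  rcases b with b | b <;> rcases a with a | a
  · rw [coneDSucc_inl]
    exact F.minimal (i + 1) b a
  · rw [coneDSucc_inl]
    exact zero_mem _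
  · rw [coneDSucc_inr]
    exact hmin (i + 1) b a
  · rw [coneDSucc_inr]
    exact neg_mem (G.minimal i b a)

variable {f : N →ₗ[MvPolynomial V k] M} {q : M →ₗ[MvPolynomial V k] Q}

theorem exact_coneDZero_augmentation (hψ₀ : ∀ z, F.ε (ψ 0 z) = f (G.ε z))
    (hfq : Function.Exact f q) : Function.Exact (coneDZero F G ψ) (q ∘ₗ F.ε) := by
  intro y
  constructor
  · intro hy
    obtain ⟨n, hn⟩ := (hfq (F.ε y)).1 hy
    obtain ⟨g, rfl⟩ := G.ε_surjective n
    obtain ⟨z, hz⟩ := (F.exact_zero (y - ψ 0 g)).1 (by rw [map_sub, hψ₀, hn, sub_self])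
    exact ⟨Sum.elim z g, by rw [coneDZero_elim, hz, sub_add_cancel]⟩
  · rintro ⟨z, rfl⟩
    rw [← Sum.elim_comp_inl_inr z, coneDZero_elim, LinearMap.comp_apply, map_add,
      F.exact_zero.apply_apply_eq_zero, zero_add, hψ₀]
    exact hfq.apply_apply_eq_zero _

/-- Lift `-y₂` through `G` to get the second coordinate; what remains of `y₁` is then a cycle of `F`
because `ψ` is a chain map. Injectivity of `f` enters only in the lowest degree, to verify `h₂`. -/
theorem exists_coneDSucc_eq (hψ' : ∀ i z, F.d i (ψ (i + 1) z) = ψ i (G.d i z)) {i : ℕ}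
    {y₁ : F.ι (i + 1) → MvPolynomial V k} {y₂ : G.ι i → MvPolynomial V k}
    (h₁ : F.d i y₁ + ψ i y₂ = 0) (h₂ : y₂ ∈ G.cycles i) :
    ∃ z, coneDSucc F G ψ i z = Sum.elim y₁ y₂ := by
  obtain ⟨g, hg⟩ := G.exists_d_eq (neg_mem h₂)
  obtain ⟨z, hz⟩ := (F.exact_succ i (y₁ - ψ (i + 1) g)).1 (by
    rw [map_sub, hψ', hg, map_neg, sub_neg_eq_add, h₁])
  exact ⟨Sum.elim z g, by rw [coneDSucc_elim, hz, hg, sub_add_cancel, neg_neg]⟩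

theorem exact_coneDSucc_zero (hψ₀ : ∀ z, F.ε (ψ 0 z) = f (G.ε z))
    (hψ' : ∀ i z, F.d i (ψ (i + 1) z) = ψ i (G.d i z)) (hf : Function.Injective f) :
    Function.Exact (coneDSucc F G ψ 0) (coneDZero F G ψ) := by
  intro y
  rw [← Sum.elim_comp_inl_inr y, coneDZero_elim]
  constructor
  · intro h
    refine exists_coneDSucc_eq hψ' h (hf ?_)
    have := congrArg F.ε h
    rw [map_add, F.exact_zero.apply_apply_eq_zero, zero_add, hψ₀] at this
    rw [this, map_zero, map_zero]
  · rintro ⟨z, hz⟩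
    rw [← Sum.elim_comp_inl_inr z, coneDSucc_elim, Sum.elim_eq_iff] at hz
    rw [← hz.1, ← hz.2, map_add, d_d, hψ', map_neg, zero_add, add_neg_cancel]

theorem exact_coneDSucc_succ (hψ' : ∀ i z, F.d i (ψ (i + 1) z) = ψ i (G.d i z)) (i : ℕ) :
    Function.Exact (coneDSucc F G ψ (i + 1)) (coneDSucc F G ψ i) := by
  intro y
  rw [← Sum.elim_comp_inl_inr y, coneDSucc_elim, ← Sum.elim_zero_zero, Sum.elim_eq_iff]
  constructor
  · intro h
    exact exists_coneDSucc_eq hψ' h.1 (neg_eq_zero.1 h.2)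
  · rintro ⟨z, hz⟩
    rw [← Sum.elim_comp_inl_inr z, coneDSucc_elim, Sum.elim_eq_iff] at hz
    rw [← hz.1, ← hz.2, map_add, d_d, hψ', map_neg, zero_add, add_neg_cancel, map_neg, d_d,
      neg_zero, neg_zero]
    exact ⟨rfl, rfl⟩

variable (F G) in
/-- The index types of the bases of the mapping cone. -/
def coneIndex : ℕ → Type
  | 0 => F.ι 0
  | i + 1 => F.ι (i + 1) ⊕ G.ι i

/-- The mapping cone of a minimal chain map `ψ` over an injective map `f : N → M` is a minimal
graded free resolution of the cokernel of `f`. -/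
noncomputable def cone [Module k Q] {𝒬 : ℤ → Submodule k Q} {e : ℤ}
    (hψ : ∀ i, IsHomMap (G.shift i) (F.shift i) e (ψ i))
    (hψ₀ : ∀ z, F.ε (ψ 0 z) = f (G.ε z)) (hψ' : ∀ i z, F.d i (ψ (i + 1) z) = ψ i (G.d i z))
    (hmin : ∀ i b a, ψ i (Pi.single b 1) a ∈ irrelevantIdeal k V)
    (hf : Function.Injective f) (hq : Function.Surjective q) (hfq : Function.Exact f q)
    (hgr : ∀ j, ∀ m ∈ ℳ j, q m ∈ 𝒬 j) : GradedResolution (V := V) 𝒬 where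
  ι := coneIndex F G
  fintype
    | 0 => inferInstanceAs (Fintype (F.ι 0))
    | i + 1 => inferInstanceAs (Fintype (F.ι (i + 1) ⊕ G.ι i))
  decEq
    | 0 => inferInstanceAs (DecidableEq (F.ι 0))
    | i + 1 => inferInstanceAs (DecidableEq (F.ι (i + 1) ⊕ G.ι i))
  shift
    | 0 => F.shift 0
    | i + 1 => Sum.elim (F.shift (i + 1)) (fun b => G.shift i b + e)
  d
    | 0 => coneDZero F G ψ
    | i + 1 => coneDSucc F G ψ i
  ε := q ∘ₗ F.ε
  d_homogeneous
    | 0 => isHomMap_coneDZero hψ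
    | i + 1 => isHomMap_coneDSucc hψ i
  ε_homogeneous b := hgr _ _ (F.ε_homogeneous b)
  ε_surjective := hq.comp F.ε_surjective
  exact_zero := exact_coneDZero_augmentation hψ₀ hfq
  exact_succ
    | 0 => exact_coneDSucc_zero hψ₀ hψ' hf
    | i + 1 => exact_coneDSucc_succ hψ' i
  minimal
    | 0 => coneDZero_apply_mem hmin
    | i + 1 => coneDSucc_apply_mem hmin i

end Cone

end GradedResolution

/-! ### Graded quotients, and the effect of adding one generator. -/

section QuotientGrading

variable {k : Type*} [Field k] {V : Type*} {I : Ideal (MvPolynomial V k)}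

theorem mem_quotientGrading {j : ℤ} {m : MvPolynomial V k ⧸ I} :
    m ∈ quotientGrading I j ↔ ∃ f, IsHom f j ∧ Ideal.Quotient.mk I f = m := by
  simp [quotientGrading, mem_weightedHomogeneousSubmodule]

theorem isGradedFamily_quotientGrading (hI : ∀ f ∈ I, ∀ j, homPart j f ∈ I) :
    IsGradedFamily (V := V) (quotientGrading I) where
  smul_mem := by
    intro f i j m hf hm
    rw [mem_quotientGrading] at hm ⊢
    obtain ⟨g, hg, rfl⟩ := hm
    exact ⟨f * g, hf.mul hg, by rw [map_mul]; rfl⟩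
  exists_proj := by
    have hs := Function.surjInv_eq (Ideal.Quotient.mk_surjective (I := I))
    set s := Function.surjInv (Ideal.Quotient.mk_surjective (I := I))
    -- The projections are defined through an arbitrary set-theoretic section `s`; homogeneity of
    -- `I` makes the result independent of it.
    have key : ∀ f g, Ideal.Quotient.mk I f = Ideal.Quotient.mk I g → ∀ j,
        Ideal.Quotient.mk I (homPart j f) = Ideal.Quotient.mk I (homPart j g) := by
      intro f g h j
      rw [Ideal.Quotient.eq] at h ⊢
      rw [← map_sub]
      exact hI _ h j
    refine ⟨fun j => AddMonoidHom.mk' (fun m => Ideal.Quotient.mk I (homPart j (s m))) ?_, ?_⟩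
    · intro a b
      rw [← map_add, ← map_add]
      refine key _ _ ?_ j
      rw [map_add, hs, hs, hs]
    · intro i j m hm
      obtain ⟨f, hf, rfl⟩ := mem_quotientGrading.1 hm
      rw [AddMonoidHom.mk'_apply, key _ f (hs _), homPart_of_isHom hf]
      split_ifs <;> simp

end QuotientGrading

/-- There is a minimal graded free resolution, of length exactly `p`, in which the maximum of
`shift i a - i` is `r`. -/
def HasInvariants {k : Type*} [Field k] {V : Type*} {M : Type*}
    [AddCommGroup M] [Module (MvPolynomial V k) M] [Module k M]
    (ℳ : ℤ → Submodule k M) (r : ℤ) (p : ℕ) : Prop :=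
  ∃ F : GradedResolution (V := V) ℳ, (∀ i a, F.shift i a ≤ r + i) ∧
    (∃ i a, F.shift i a = r + i) ∧ (∀ i, p < i → IsEmpty (F.ι i)) ∧ Nonempty (F.ι p)

section Invariants

variable {k : Type*} [Field k] {V : Type*} {M N Q : Type*}
    [AddCommGroup M] [Module (MvPolynomial V k) M] [Module k M]
    [AddCommGroup N] [Module (MvPolynomial V k) N] [Module k N]
    [AddCommGroup Q] [Module (MvPolynomial V k) Q] [Module k Q]
    {ℳ : ℤ → Submodule k M} {𝒩 : ℤ → Submodule k N} {𝒬 : ℤ → Submodule k Q}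

/-- Lifting `g` and then multiplying by `x` yields a chain map with entries in the irrelevant ideal,
so no cancellation occurs in the cone. The summands of `G` move up by `e + 1` in degree and by `1`
in homological position, hence `r' + e` and `p' + 1`. -/
theorem HasInvariants.cokernel {r r' : ℤ} {p p' : ℕ} (hM : HasInvariants (V := V) ℳ r p)
    (hN : HasInvariants (V := V) 𝒩 r' p') (hℳ : IsGradedFamily (V := V) ℳ) {e : ℤ}
    (g : N →ₗ[MvPolynomial V k] M) (hg : ∀ j, ∀ m ∈ 𝒩 j, g m ∈ ℳ (j + e))
    (x : MvPolynomial V k) (hx : IsHom x 1) (q : M →ₗ[MvPolynomial V k] Q)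
    (hf : Function.Injective (x • g)) (hq : Function.Surjective q)
    (hfq : Function.Exact (x • g : N →ₗ[MvPolynomial V k] M) q)
    (hgr : ∀ j, ∀ m ∈ ℳ j, q m ∈ 𝒬 j) :
    HasInvariants (V := V) 𝒬 (max r (r' + e)) (max p (p' + 1)) := by
  obtain ⟨F, hF₁, ⟨iF, aF, hF₂⟩, hF₃, hF₄⟩ := hM
  obtain ⟨G, hG₁, ⟨iG, aG, hG₂⟩, hG₃, hG₄⟩ := hN
  obtain ⟨φ, hφ, hφ₀, hφ'⟩ := G.exists_lift F hℳ g hg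
  have hx' : x ∈ irrelevantIdeal k V := by
    by_contra h
    exact one_ne_zero (IsHom.eq_zero_of_notMem hx h)
  have hψ : ∀ i, IsHomMap (G.shift i) (F.shift i) (e + 1) (x • φ i) := fun i b a => by
    have := hx.mul (hφ i b a)
    rwa [show 1 + (G.shift i b + e - F.shift i a) = G.shift i b + (e + 1) - F.shift i a by
      ring] at this
  let C : GradedResolution (V := V) 𝒬 := GradedResolution.cone (F := F) (G := G)
    (ψ := fun i => x • φ i) (e := e + 1) hψ
    (by simp [hφ₀]) (by simp [hφ']) (fun i b a => Ideal.mul_mem_right _ _ hx') hf hq hfq hgr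
  have hC₀ : ∀ a : F.ι 0, C.shift 0 a = F.shift 0 a := fun _ => rfl
  have hC₁ : ∀ i (a : F.ι (i + 1)), C.shift (i + 1) (Sum.inl a) = F.shift (i + 1) a :=
    fun _ _ => rfl
  have hC₂ : ∀ i (a : G.ι i), C.shift (i + 1) (Sum.inr a) = G.shift i a + (e + 1) :=
    fun _ _ => rfl
  refine ⟨C, ?_, ?_, ?_, ?_⟩
  · rintro (_ | i) a
    · exact (hF₁ 0 a).trans (by gcongr; exact le_max_left _ _)
    · rcases a with a | a
      · exact (hF₁ (i + 1) a).trans (by gcongr; exact le_max_left _ _)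
      · rw [hC₂]
        have := hG₁ i a
        have := le_max_right r (r' + e)
        push_cast
        linarith
  · rcases le_total r (r' + e) with h | h
    · rw [max_eq_right h]
      exact ⟨iG + 1, Sum.inr aG, by rw [hC₂, hG₂]; push_cast; ring⟩
    · rw [max_eq_left h]
      rcases iF with _ | i
      · exact ⟨0, aF, hF₂⟩
      · exact ⟨i + 1, Sum.inl aF, hF₂⟩
  · rintro (_ | i) hi
    · omega
    · have := hF₃ (i + 1) (by omega)
      have := hG₃ i (by omega)
      exact inferInstanceAs (IsEmpty (F.ι (i + 1) ⊕ G.ι i))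
  · rcases le_total p (p' + 1) with h | h
    · rw [max_eq_right h]
      exact ⟨Sum.inr hG₄.some⟩
    · rw [max_eq_left h]
      rcases p with _ | p
      · exact hF₄
      · exact ⟨Sum.inl hF₄.some⟩

/-- Adding a generator `x * m`, with `x` a linear form such that `(I : x * m) = (I : m)`. -/
theorem HasInvariants.sup_span_mul {I J : Ideal (MvPolynomial V k)} {r r' : ℤ} {p p' : ℕ}
    (hI : HasInvariants (V := V) (quotientGrading I) r p)
    (hJ : HasInvariants (V := V) (quotientGrading J) r' p')
    (hgr : ∀ f ∈ I, ∀ j, homPart j f ∈ I) {x m : MvPolynomial V k} {e : ℤ}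
    (hx : IsHom x 1) (hm : IsHom m e) (hJI : ∀ f ∈ J, m * f ∈ I)
    (hIJ : ∀ f, x * m * f ∈ I → f ∈ J) :
    HasInvariants (V := V) (quotientGrading (I ⊔ Ideal.span {x * m}))
      (max r (r' + e)) (max p (p' + 1)) := by
  let g : (MvPolynomial V k ⧸ J) →ₗ[MvPolynomial V k] (MvPolynomial V k ⧸ I) :=
    Submodule.mapQ J I (LinearMap.mulLeft _ m) hJI
  let q : (MvPolynomial V k ⧸ I) →ₗ[MvPolynomial V k]
      (MvPolynomial V k ⧸ (I ⊔ Ideal.span {x * m})) :=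
    Submodule.mapQ I (I ⊔ Ideal.span {x * m}) LinearMap.id
      (fun _ h => Ideal.mem_sup_left h)
  have hg : ∀ f, g (Ideal.Quotient.mk J f) = Ideal.Quotient.mk I (m * f) := fun _ => rfl
  have hxg : ∀ f, (x • g) (Ideal.Quotient.mk J f) = Ideal.Quotient.mk I (x * m * f) := fun f => by
    rw [LinearMap.smul_apply, hg, mul_assoc]; rfl
  have hq : ∀ f, q (Ideal.Quotient.mk I f) = Ideal.Quotient.mk _ f := fun _ => rfl
  refine hI.cokernel hJ (isGradedFamily_quotientGrading hgr) g ?_ x hx q ?_ ?_ ?_ ?_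
  · intro j n hn
    obtain ⟨f, hf, rfl⟩ := mem_quotientGrading.1 hn
    refine mem_quotientGrading.2 ⟨m * f, ?_, rfl⟩
    rw [add_comm]
    exact hm.mul hf
  · refine (injective_iff_map_eq_zero _).2 fun n hn => ?_
    obtain ⟨f, rfl⟩ := Ideal.Quotient.mk_surjective n
    rw [hxg, Ideal.Quotient.eq_zero_iff_mem] at hn
    exact Ideal.Quotient.eq_zero_iff_mem.2 (hIJ f hn)
  · intro n
    obtain ⟨f, rfl⟩ := Ideal.Quotient.mk_surjective n
    exact ⟨Ideal.Quotient.mk I f, hq f⟩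
  · intro n
    obtain ⟨f, rfl⟩ := Ideal.Quotient.mk_surjective n
    rw [hq, Ideal.Quotient.eq_zero_iff_mem]
    constructor
    · intro h
      obtain ⟨a, ha, b, hb, rfl⟩ := Submodule.mem_sup.1 h
      obtain ⟨c, rfl⟩ := Ideal.mem_span_singleton'.1 hb
      refine ⟨Ideal.Quotient.mk J c, ?_⟩
      rw [hxg, map_add, Ideal.Quotient.eq_zero_iff_mem.2 ha, zero_add, mul_comm c]
    · rintro ⟨n, hn⟩
      obtain ⟨c, rfl⟩ := Ideal.Quotient.mk_surjective n
      rw [hxg] at hn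
      have h := Ideal.Quotient.eq.1 hn.symm
      rw [← sub_add_cancel f (x * m * c)]
      exact add_mem (Ideal.mem_sup_left h)
        (Ideal.mem_sup_right (Ideal.mul_mem_right _ _ (Ideal.mem_span_singleton_self _)))
  · intro j n hn
    obtain ⟨f, hf, rfl⟩ := mem_quotientGrading.1 hn
    exact mem_quotientGrading.2 ⟨f, hf, rfl⟩

/-- The free resolution of `S / 0`. -/
theorem hasInvariants_bot :
    HasInvariants (V := V) (quotientGrading (⊥ : Ideal (MvPolynomial V k))) 0 0 := by
  let F : GradedResolution (V := V) (quotientGrading (⊥ : Ideal (MvPolynomial V k))) :=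
    { ι := fun i => match i with
        | 0 => Unit
        | _ + 1 => Empty
      fintype := fun i => match i with
        | 0 => inferInstanceAs (Fintype Unit)
        | _ + 1 => inferInstanceAs (Fintype Empty)
      decEq := fun i => match i with
        | 0 => inferInstanceAs (DecidableEq Unit)
        | _ + 1 => inferInstanceAs (DecidableEq Empty)
      shift := fun _ _ => 0
      d := fun _ => 0
      ε := (Submodule.mkQ (⊥ : Ideal (MvPolynomial V k))).comp (LinearMap.proj ())
      d_homogeneous := fun _ b => b.elim
      ε_homogeneous := fun b => mem_quotientGrading.2
        ⟨1, isWeightedHomogeneous_one _ _, rfl⟩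
      ε_surjective := fun n => by
        obtain ⟨f, rfl⟩ := Ideal.Quotient.mk_surjective n
        exact ⟨fun _ => f, rfl⟩
      exact_zero := fun y => by
        have h : Ideal.Quotient.mk (⊥ : Ideal (MvPolynomial V k)) (y ()) = 0 ↔ y = 0 := by
          rw [Ideal.Quotient.eq_zero_iff_mem, Ideal.mem_bot]
          exact ⟨fun h => funext fun _ => h, fun h => congrFun h ()⟩
        exact h.trans ⟨fun h => ⟨0, h.symm⟩, fun ⟨_, h⟩ => h.symm⟩
      exact_succ := fun i y => ⟨fun _ => ⟨0, funext fun a => a.elim⟩, fun _ => rfl⟩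
      minimal := fun _ b => b.elim }
  refine ⟨F, fun i a => ?_, ⟨0, (), rfl⟩, fun i hi => ?_, ⟨()⟩⟩
  · change (0 : ℤ) ≤ 0 + i
    positivity
  · obtain ⟨i, rfl⟩ := Nat.exists_eq_succ_of_ne_zero hi.ne'
    exact inferInstanceAs (IsEmpty Empty)

end Invariants

/-! ### Projective dimension from a minimal resolution. -/

section ProjectiveDimension

open CategoryTheory

universe u v

theorem hasProjectiveDimensionLT_iff_ker {R : Type u} [CommRing R] {A B : Type u} [AddCommGroup A]
    [Module R A] [AddCommGroup B] [Module R B] [Module.Projective R A] {f : A →ₗ[R] B}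
    (hf : Function.Surjective f) {K : Submodule R A} (hK : LinearMap.ker f = K) (n : ℕ) :
    HasProjectiveDimensionLT (ModuleCat.of R B) (n + 2) ↔
      HasProjectiveDimensionLT (ModuleCat.of R K) (n + 1) := by
  subst hK
  exact (LinearMap.shortExact_shortComplexKer hf).hasProjectiveDimensionLT_X₃_iff n
    ((IsProjective.iff_projective _).1 inferInstance)

/-- This direction of dimension shifting also covers `n = 0`, where a zero kernel makes `B`
projective, while the converse fails. -/
theorem hasProjectiveDimensionLT_of_ker {R : Type u} [CommRing R] {A B : Type u} [AddCommGroup A]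
    [Module R A] [AddCommGroup B] [Module R B] [Module.Projective R A] {f : A →ₗ[R] B}
    (hf : Function.Surjective f) {K : Submodule R A} (hK : LinearMap.ker f = K) (n : ℕ)
    (h : HasProjectiveDimensionLT (ModuleCat.of R K) n) :
    HasProjectiveDimensionLT (ModuleCat.of R B) (n + 1) := by
  subst hK
  have hA : Projective (ModuleCat.of R A) := (IsProjective.iff_projective _).1 inferInstance
  have hA' : HasProjectiveDimensionLT (ModuleCat.of R A) 1 := inferInstance
  exact (LinearMap.shortExact_shortComplexKer hf).hasProjectiveDimensionLT_X₃ n h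
    (hasProjectiveDimensionLT_of_ge _ 1 (n + 1) (by omega))

/-- A minimal surjection from a finite free module onto a projective module is injective. -/
theorem ker_eq_bot_of_projective {R ι B : Type*} [CommRing R] [IsDomain R] [Fintype ι]
    [DecidableEq ι] [AddCommGroup B] [Module R B] [Module.Projective R B] {I : Ideal R}
    (hI : I ≠ ⊤) {f : (ι → R) →ₗ[R] B} (hf : Function.Surjective f)
    (hmin : ∀ z ∈ LinearMap.ker f, ∀ a, z a ∈ I) : LinearMap.ker f = ⊥ := by
  obtain ⟨s, hs⟩ := Module.projective_lifting_property f LinearMap.id hf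
  have hs' : ∀ b, f (s b) = b := fun b => LinearMap.congr_fun hs b
  set r : (ι → R) →ₗ[R] (ι → R) := LinearMap.id - s ∘ₗ f
  have hr : ∀ z ∈ LinearMap.ker f, r z = z := fun z hz => by
    have : f z = 0 := hz
    simp [r, this]
  have hr' : ∀ z, r z ∈ LinearMap.ker f := fun z => by simp [r, hs']
  have hrange : LinearMap.ker f = LinearMap.range r :=
    le_antisymm (fun z hz => ⟨z, hr z hz⟩) (by rintro _ ⟨z, rfl⟩; exact hr' z)
  have hfg : (LinearMap.ker f).FG := by
    rw [hrange, LinearMap.range_eq_map]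
    exact Module.Finite.fg_top.map _
  have hle : LinearMap.ker f ≤ I • LinearMap.ker f := fun z hz => by
    rw [← hr z hz, linearMap_apply_eq_sum]
    exact Submodule.sum_mem _ fun b _ => Submodule.smul_mem_smul (hmin z hz b) (hr' _)
  -- The kernel is a finitely generated summand equal to `I` times itself. As the ring is not local,
  -- Nakayama's lemma only gives `c ≡ 1` modulo `I` annihilating it; `c ≠ 0`, and the free module
  -- over a domain is torsion-free.
  obtain ⟨c, hc, hc'⟩ := Submodule.exists_sub_one_mem_and_smul_eq_zero_of_fg_of_le_smul _ _ hfg hle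
  have hc0 : c ≠ 0 := by
    rintro rfl
    refine hI ((Ideal.eq_top_iff_one I).2 ?_)
    simpa using neg_mem hc
  refine (Submodule.eq_bot_iff _).2 fun z hz => ?_
  funext a
  exact (mul_eq_zero.1 (congrFun (hc' z hz) a)).resolve_left hc0

namespace GradedResolution

variable {k : Type u} [Field k] {V : Type v} {M : Type (max u v)}
    [AddCommGroup M] [Module (MvPolynomial V k) M] [Module k M] {ℳ : ℤ → Submodule k M}

/-- The differential, as a map onto the cycles. -/
noncomputable def toCycles (F : GradedResolution (V := V) ℳ) (i : ℕ) :
    (F.ι (i + 1) → MvPolynomial V k) →ₗ[MvPolynomial V k] F.cycles i :=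
  (F.d i).codRestrict _ (F.d_mem_cycles i)

theorem toCycles_surjective (F : GradedResolution (V := V) ℳ) (i : ℕ) :
    Function.Surjective (F.toCycles i) := fun z => by
  obtain ⟨y, hy⟩ := F.exists_d_eq z.2
  exact ⟨y, Subtype.ext hy⟩

theorem ker_toCycles (F : GradedResolution (V := V) ℳ) (i : ℕ) :
    LinearMap.ker (F.toCycles i) = F.cycles (i + 1) := LinearMap.ker_codRestrict _ _ _

theorem single_notMem_cycles (F : GradedResolution (V := V) ℳ) (i : ℕ) (a : F.ι i) :
    Pi.single a 1 ∉ F.cycles i := fun h => by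
  obtain ⟨y, hy⟩ := F.exists_d_eq h
  have := F.d_apply_mem i y a
  rw [hy, Pi.single_eq_same] at this
  exact one_notMem_irrelevantIdeal this

theorem apply_mem_of_mem_cycles (F : GradedResolution (V := V) ℳ) {i : ℕ}
    {z : F.ι i → MvPolynomial V k} (hz : z ∈ F.cycles i) (a : F.ι i) :
    z a ∈ irrelevantIdeal k V := by
  obtain ⟨y, rfl⟩ := F.exists_d_eq hz
  exact F.d_apply_mem i y a

theorem hasProjectiveDimensionLT_succ (F : GradedResolution (V := V) ℳ) {p : ℕ}
    (h : IsEmpty (F.ι (p + 1))) :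
    HasProjectiveDimensionLT (ModuleCat.of (MvPolynomial V k) M) (p + 1) := by
  have key : ∀ j i, i + j = p →
      HasProjectiveDimensionLT (ModuleCat.of (MvPolynomial V k) (F.cycles i)) j := by
    intro j
    induction j with
    | zero =>
      rintro i rfl
      have : Subsingleton (F.cycles i) := (F.toCycles_surjective i).subsingleton
      exact (ModuleCat.isZero_of_subsingleton _).hasProjectiveDimensionLT_zero
    | succ j ih =>
      intro i hi
      exact hasProjectiveDimensionLT_of_ker (F.toCycles_surjective i) (F.ker_toCycles i) j
        (ih (i + 1) (by omega))
  exact hasProjectiveDimensionLT_of_ker F.ε_surjective rfl p (key p 0 (zero_add p))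

/-- For `p > 0`, dimension shifting would make the module covered by `F_{p-1}` projective (`M`
itself if `p = 1`). Minimality then makes this cover injective, so the next differential is zero and
a basis vector of `F_p` is a cycle, against minimality. -/
theorem not_hasProjectiveDimensionLT (F : GradedResolution (V := V) ℳ) {p : ℕ} (a : F.ι p) :
    ¬HasProjectiveDimensionLT (ModuleCat.of (MvPolynomial V k) M) p := by
  intro h
  have hI : irrelevantIdeal k V ≠ ⊤ := fun h =>
    one_notMem_irrelevantIdeal (h ▸ Submodule.mem_top : (1 : MvPolynomial V k) ∈ _)
  rcases p with _ | p
  · have := ModuleCat.subsingleton_of_isZero ((hasProjectiveDimensionLT_zero_iff_isZero _).1 h)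
    exact F.single_notMem_cycles 0 a (Subsingleton.elim (α := M) _ _)
  suffices hp : F.cycles p = ⊥ by
    refine F.single_notMem_cycles (p + 1) a ?_
    have : F.d p (Pi.single a 1) ∈ F.cycles p := F.d_mem_cycles p _
    rwa [hp] at this
  rcases p with _ | p
  · have := (IsProjective.iff_projective M (R := MvPolynomial V k)).2
      (projective_iff_hasProjectiveDimensionLT_one.2 h)
    exact ker_eq_bot_of_projective hI F.ε_surjective fun z hz a =>
      F.apply_mem_of_mem_cycles (i := 0) hz a
  · have key : ∀ i j, i + j = p →
        HasProjectiveDimensionLT (ModuleCat.of (MvPolynomial V k) (F.cycles i)) (j + 1) := by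
      intro i
      induction i with
      | zero =>
        rintro j hj
        obtain rfl : j = p := by omega
        exact (hasProjectiveDimensionLT_iff_ker F.ε_surjective rfl j).1 h
      | succ i ih =>
        intro j hj
        exact (hasProjectiveDimensionLT_iff_ker (F.toCycles_surjective i) (F.ker_toCycles i) j).1
          (ih (j + 1) (by omega))
    have := (IsProjective.iff_projective (F.cycles p) (R := MvPolynomial V k)).2
      (projective_iff_hasProjectiveDimensionLT_one.2 (key p 0 rfl))
    rw [← F.ker_toCycles]
    refine ker_eq_bot_of_projective hI (F.toCycles_surjective p) fun z hz a => ?_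
    rw [F.ker_toCycles] at hz
    exact F.apply_mem_of_mem_cycles hz a

end GradedResolution

theorem HasInvariants.projectiveDimension_eq {k : Type u} [Field k] {V : Type v}
    {M : Type (max u v)} [AddCommGroup M] [Module (MvPolynomial V k) M] [Module k M]
    {ℳ : ℤ → Submodule k M} {r : ℤ} {p : ℕ} (h : HasInvariants (V := V) ℳ r p) :
    projectiveDimension (ModuleCat.of (MvPolynomial V k) M) = ((p : ℕ∞) : WithBot ℕ∞) := by
  obtain ⟨F, -, -, hF, ⟨a⟩⟩ := h
  exact le_antisymm
    ((projectiveDimension_le_iff _ p).2 (F.hasProjectiveDimensionLT_succ (hF _ p.lt_succ_self)))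
    ((projectiveDimension_ge_iff _ p).2 (F.not_hasProjectiveDimensionLT a))

end ProjectiveDimension

/-! ### Squarefree monomial ideals through the supports of their monomials. -/

section SquarefreeMonomialIdeals

variable {k : Type*} [Field k] {V : Type*}

variable (k) in
/-- The squarefree monomial ideal generated by the products of the variables in the members of
`𝒯`. -/
noncomputable def squarefreeIdeal (𝒯 : Set (Finset V)) : Ideal (MvPolynomial V k) :=
  Ideal.span ((fun T : Finset V => ∏ u ∈ T, X u) '' 𝒯)

theorem prod_X_eq_monomial (T : Finset V) :
    (∏ u ∈ T, X u : MvPolynomial V k) = monomial (Finsupp.indicator T fun _ _ => 1) 1 := by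
  classical
  rw [monomial_eq, Finsupp.prod, C_1, one_mul]
  have : (Finsupp.indicator T fun _ _ => (1 : ℕ)).support = T := by
    ext a; simp [Finsupp.indicator_apply]
  rw [this]
  exact Finset.prod_congr rfl fun a ha => by simp [ha]

theorem indicator_le_iff {T : Finset V} {α : V →₀ ℕ} :
    (Finsupp.indicator T fun _ _ => 1) ≤ α ↔ T ⊆ α.support := by
  classical
  constructor
  · intro h a ha
    have := h a
    rw [Finsupp.indicator_of_mem ha] at this
    rw [Finsupp.mem_support_iff]
    omega
  · intro h a
    by_cases ha : a ∈ T
    · have := Finsupp.mem_support_iff.1 (h ha)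
      rw [Finsupp.indicator_of_mem ha]
      omega
    · rw [Finsupp.indicator_of_notMem ha]
      exact Nat.zero_le _

theorem mem_squarefreeIdeal {𝒯 : Set (Finset V)} {f : MvPolynomial V k} :
    f ∈ squarefreeIdeal k 𝒯 ↔ ∀ α ∈ f.support, ∃ T ∈ 𝒯, T ⊆ α.support := by
  have : ((fun T : Finset V => (∏ u ∈ T, X u : MvPolynomial V k)) '' 𝒯) =
      (fun s => monomial s (1 : k)) '' ((fun T => Finsupp.indicator T fun _ _ => 1) '' 𝒯) := by
    rw [Set.image_image]
    exact Set.image_congr fun T _ => prod_X_eq_monomial T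
  rw [squarefreeIdeal, this, mem_ideal_span_monomial_image]
  simp [indicator_le_iff]

theorem homPart_mem_squarefreeIdeal {𝒯 : Set (Finset V)} {f : MvPolynomial V k}
    (hf : f ∈ squarefreeIdeal k 𝒯) (j : ℤ) : homPart j f ∈ squarefreeIdeal k 𝒯 := by
  classical
  rw [mem_squarefreeIdeal] at hf ⊢
  intro α hα
  rw [support_weightedHomogeneousComponent] at hα
  exact hf α (Finset.mem_filter.1 hα).1

theorem prod_X_mul_mem_squarefreeIdeal [DecidableEq V] {𝒯 : Set (Finset V)} (S : Finset V)
    {f : MvPolynomial V k} : (∏ u ∈ S, X u) * f ∈ squarefreeIdeal k 𝒯 ↔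
      ∀ α ∈ f.support, ∃ T ∈ 𝒯, T ⊆ S ∪ α.support := by
  have hs : ∀ α : V →₀ ℕ, ((Finsupp.indicator S fun _ _ => 1) + α).support = S ∪ α.support := by
    intro α
    ext a
    by_cases h : a ∈ S <;> simp [Finsupp.indicator_apply, h]
  rw [mem_squarefreeIdeal, prod_X_eq_monomial]
  constructor
  · intro h α hα
    rw [← hs]
    refine h _ ?_
    rw [mem_support_iff, coeff_monomial_mul, one_mul]
    exact mem_support_iff.1 hα
  · intro h β hβ
    rw [mem_support_iff, coeff_monomial_mul'] at hβ
    split_ifs at hβ with hle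
    · rw [one_mul] at hβ
      obtain ⟨T, hT, hTα⟩ := h _ (mem_support_iff.2 hβ)
      refine ⟨T, hT, ?_⟩
      rwa [← hs, add_tsub_cancel_of_le hle] at hTα
    · exact absurd rfl hβ

theorem isHom_prod_X (T : Finset V) : IsHom (∏ u ∈ T, X u : MvPolynomial V k) T.card := by
  have := IsWeightedHomogeneous.prod T (fun u => (X u : MvPolynomial V k)) (fun _ => (1 : ℤ))
    (w := fun _ : V => (1 : ℤ)) (fun u _ => isWeightedHomogeneous_X k _ u)
  simpa using this

variable (k) in
/-- The squarefree monomial ideal, whose monomials have the supports satisfying `P`, has a quotient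
of regularity `r` and projective dimension `p`. -/
def SupportInvariants (P : Finset V → Prop) (r : ℤ) (p : ℕ) : Prop :=
  ∃ 𝒯 : Set (Finset V), (∀ s, P s ↔ ∃ T ∈ 𝒯, T ⊆ s) ∧
    HasInvariants (V := V) (quotientGrading (squarefreeIdeal k 𝒯)) r p

theorem supportInvariants_false : SupportInvariants k (fun _ : Finset V => False) 0 0 := by
  have : squarefreeIdeal k (∅ : Set (Finset V)) = ⊥ := by simp [squarefreeIdeal]
  exact ⟨∅, by simp, by rw [this]; exact hasInvariants_bot⟩

/-- A colon ideal by the product over `T` corresponds to the condition `P (T ∪ s)`. The two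
implications give `(I : x_x x_T) ⊆ J ⊆ (I : x_T)`, and the reverse inclusion of the outer ideals is
automatic, so all three coincide. -/
theorem SupportInvariants.or_subset [DecidableEq V] {P Q : Finset V → Prop} {r r' : ℤ} {p p' : ℕ}
    (hP : SupportInvariants k P r p) (hQ : SupportInvariants k Q r' p') {x : V} {T : Finset V}
    (hx : x ∉ T) (hPQ : ∀ s, P (insert x T ∪ s) → Q s) (hQP : ∀ s, Q s → P (T ∪ s)) :
    SupportInvariants k (fun s => P s ∨ insert x T ⊆ s)
      (max r (r' + T.card)) (max p (p' + 1)) := by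
  obtain ⟨𝒮, h𝒮, hP⟩ := hP
  obtain ⟨𝒬, h𝒬, hQ⟩ := hQ
  refine ⟨insert (insert x T) 𝒮, fun s => by simp [h𝒮, or_comm], ?_⟩
  have hI : squarefreeIdeal k (insert (insert x T) 𝒮) =
      squarefreeIdeal k 𝒮 ⊔ Ideal.span {X x * ∏ u ∈ T, X u} := by
    rw [squarefreeIdeal, Set.image_insert_eq, Ideal.span_insert, sup_comm, Finset.prod_insert hx,
      squarefreeIdeal]
  rw [hI]
  refine hP.sup_span_mul hQ (fun f hf j => homPart_mem_squarefreeIdeal hf j)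
    (isWeightedHomogeneous_X _ _ _) (isHom_prod_X T) (fun f hf => ?_) (fun f hf => ?_)
  · rw [prod_X_mul_mem_squarefreeIdeal]
    rw [mem_squarefreeIdeal] at hf
    exact fun α hα => (h𝒮 _).1 (hQP _ ((h𝒬 _).2 (hf α hα)))
  · rw [← Finset.prod_insert hx, prod_X_mul_mem_squarefreeIdeal] at hf
    rw [mem_squarefreeIdeal]
    exact fun α hα => (h𝒬 _).1 (hPQ _ ((h𝒮 _).2 (hf α hα)))

theorem SupportInvariants.hasInvariants {P : Finset V → Prop} {r : ℤ} {p : ℕ}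
    (hP : SupportInvariants k P r p) {𝒯 : Set (Finset V)} (h : ∀ s, P s ↔ ∃ T ∈ 𝒯, T ⊆ s) :
    HasInvariants (V := V) (quotientGrading (squarefreeIdeal k 𝒯)) r p := by
  obtain ⟨𝒮, h𝒮, hP⟩ := hP
  have : squarefreeIdeal k 𝒯 = squarefreeIdeal k 𝒮 := by
    ext f
    simp only [mem_squarefreeIdeal, ← h, ← h𝒮]
  rwa [this]

end SquarefreeMonomialIdeals

/-! ### The two recursions for the square of a path. -/

section PathSquare

variable (k : Type*) [Field k] {n : ℕ}

/-- `s` contains the first `m` vertices within distance `2` of `w`, for some `w < u`. -/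
def ContainsNeighborhood (m u : ℕ) (s : Finset (Fin n)) : Prop :=
  ∃ w < u, ∀ i : Fin n, i.val < m → w ≤ i + 2 → i ≤ w + 2 → i ∈ s

theorem supportInvariants_containsNeighborhood_zero (m : ℕ) :
    SupportInvariants k (ContainsNeighborhood (n := n) m 0) 0 0 := by
  have : ContainsNeighborhood (n := n) m 0 = fun _ => False := by
    funext s; simp [ContainsNeighborhood]
  rw [this]
  exact supportInvariants_false

/-- The ideal generated by the complete intervals of length five (and an initial one of
length three). -/
theorem supportInvariants_containsNeighborhood (u : ℕ) (hu : u + 2 ≤ n ∨ u = 0) :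
    SupportInvariants k (ContainsNeighborhood (n := n) n u)
      (2 * ((u + 2) / 3 : ℕ)) ((u + 2) / 3) := by
  induction u using Nat.strong_induction_on with
  | _ u ih =>
  rcases u with _ | u
  · simpa using supportInvariants_containsNeighborhood_zero k n
  by_cases h0 : u = 0
  · subst h0
    have := (ih 0 (by omega) (Or.inr rfl)).or_subset (ih 0 (by omega) (Or.inr rfl))
      (x := ⟨2, by omega⟩) (T := Finset.Icc ⟨0, by omega⟩ ⟨1, by omega⟩)
      (by simp [Fin.le_def]) (fun s ⟨w, hw, _⟩ => by omega) (fun s ⟨w, hw, _⟩ => by omega)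
    convert this using 1
    · funext s
      refine propext ⟨fun ⟨w, hw, h⟩ => Or.inr fun i hi => h i i.2 ?_ ?_, ?_⟩
      · omega
      · simp [Fin.le_def, Fin.ext_iff] at hi
        omega
      · rintro (⟨w, hw, _⟩ | h)
        · omega
        · refine ⟨0, by omega, fun i _ _ hi => h ?_⟩
          simp [Fin.le_def, Fin.ext_iff]
          omega
    · simp
    · simp
  -- The neighborhoods of vertices `1` and `2` contain that of `0`, so they are redundant
  -- generators.
  by_cases h3 : u < 3
  · have := ih u (by omega) (by omega)
    convert this using 1
    · funext s
      refine propext ⟨fun ⟨w, hw, h⟩ => ⟨0, by omega, fun i hi h₁ h₂ => h i hi ?_ ?_⟩,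
        fun ⟨w, hw, h⟩ => ⟨w, by omega, h⟩⟩ <;> omega
    · have : (u + 1 + 2) / 3 = (u + 2) / 3 := by omega
      rw [this]
    · omega
  · have hu' : u + 3 ≤ n := by omega
    have h₁ := ih u (by omega) (by omega)
    have h₂ := ih (u - 5) (by omega) (by omega)
    -- The generators of `I_{u-5}` involve only vertices up to `u - 4`, so `x_{u-3}` is a new
    -- variable: it raises the projective dimension by 1 and, since `T = ∅`, leaves the regularity
    -- unchanged. For `u < 5` the truncated `u - 5` gives the zero ideal, as required.
    have h₃ := h₂.or_subset h₂ (x := ⟨u - 3, by omega⟩) (T := ∅) (by simp) (by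
      rintro s ⟨w, hw, h⟩
      refine ⟨w, hw, fun i hi h₁ h₂ => ?_⟩
      have := h i hi h₁ h₂
      simp [Fin.ext_iff] at this
      rcases this with h | h
      · omega
      · exact h) (by simp)
    have h₄ := h₁.or_subset h₃ (x := ⟨u + 2, by omega⟩)
      (T := Finset.Icc ⟨u - 2, by omega⟩ ⟨u + 1, by omega⟩) (by simp [Fin.le_def]) (by
      rintro s ⟨w, hw, h⟩
      -- For `u - 5 ≤ w < u` the neighborhood of `w` contains `u - 3`, which lies outside the added
      -- interval; this forces `u - 3 ∈ s`.
      by_cases hw' : w < u - 5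
      · refine Or.inl ⟨w, hw', fun i hi h₁ h₂ => ?_⟩
        have := h i hi h₁ h₂
        simp [Fin.le_def, Fin.ext_iff] at this
        rcases this with h | h | h
        · omega
        · omega
        · exact h
      · refine Or.inr ?_
        have := h ⟨u - 3, by omega⟩ (by simp; omega) (by simp; omega) (by simp; omega)
        simp [Fin.le_def] at this
        rcases this with h | h | h
        · omega
        · omega
        · simpa using h) (by
      rintro s (⟨w, hw, h⟩ | h)
      · exact ⟨w, by omega, fun i hi h₁ h₂ => Finset.mem_union_right _ (h i hi h₁ h₂)⟩
      -- The neighborhood of `u - 1` is `[u-3, u+1]`, that is, `T` together with `u - 3`.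
      · refine ⟨u - 1, by omega, fun i hi h₁ h₂ => ?_⟩
        by_cases hi' : i = ⟨u - 3, by omega⟩
        · exact Finset.mem_union_right _ (h (by simp [hi']))
        · refine Finset.mem_union_left _ ?_
          simp [Fin.le_def, Fin.ext_iff] at hi' ⊢
          omega)
    convert h₄ using 1
    · funext s
      refine propext ⟨fun ⟨w, hw, h⟩ => ?_, ?_⟩
      · by_cases hw' : w < u
        · exact Or.inl ⟨w, hw', h⟩
        · refine Or.inr fun i hi => h i i.2 ?_ ?_ <;>
          · simp [Fin.le_def, Fin.ext_iff] at hi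
            omega
      · rintro (⟨w, hw, h⟩ | h)
        · exact ⟨w, by omega, h⟩
        · refine ⟨u, by omega, fun i hi h₁ h₂ => h ?_⟩
          simp [Fin.le_def, Fin.ext_iff]
          omega
    · simp
      omega
    · omega

/-- Among the last three vertices, `m + 2` has the smallest neighborhood `{m, m+1, m+2}`, contained
in the other two. The earlier neighborhoods avoid `m + 2`, and dividing out `x_m x_{m+1}` truncates
them to the first `m` vertices, which gives the same problem for `m`. In both maxima the term from
this colon ideal dominates. -/
theorem supportInvariants_containsNeighborhood_self (m : ℕ) (hm : m ≤ n) :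
    SupportInvariants k (ContainsNeighborhood (n := n) m m)
      (2 * (m / 3 : ℕ) + if m % 3 = 2 then 1 else 0) ((m + 2) / 3) := by
  induction m using Nat.strong_induction_on with
  | _ m ih =>
  match m, hm, ih with
  | 0, _, _ => simpa using supportInvariants_containsNeighborhood_zero k 0
  | 1, hm, ih =>
    have h := ih 0 (by omega) (by omega)
    have := h.or_subset h (x := ⟨0, by omega⟩) (T := ∅) (by simp)
      (fun s ⟨w, hw, _⟩ => by omega) (fun s ⟨w, hw, _⟩ => by omega)
    convert this using 1
    · funext s
      refine propext ⟨fun ⟨w, hw, h⟩ => Or.inr ?_, ?_⟩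
      · simpa using h ⟨0, by omega⟩ (by simp) (by simp; omega) (by simp)
      · rintro (⟨w, hw, _⟩ | h)
        · omega
        · refine ⟨0, by omega, fun i hi _ _ => h ?_⟩
          simp [Fin.ext_iff]
          omega
    · simp
    · simp
  | 2, hm, ih =>
    have h := ih 0 (by omega) (by omega)
    have := h.or_subset h (x := ⟨1, by omega⟩) (T := {⟨0, by omega⟩}) (by simp)
      (fun s ⟨w, hw, _⟩ => by omega) (fun s ⟨w, hw, _⟩ => by omega)
    convert this using 1
    · funext s
      refine propext ⟨fun ⟨w, hw, h⟩ => Or.inr fun i hi => h i ?_ ?_ ?_, ?_⟩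
      · simp [Fin.ext_iff] at hi; omega
      · simp [Fin.ext_iff] at hi; omega
      · simp [Fin.ext_iff] at hi; omega
      · rintro (⟨w, hw, _⟩ | h)
        · omega
        · refine ⟨0, by omega, fun i hi _ _ => h ?_⟩
          simp [Fin.ext_iff]
          omega
    · simp
    · simp
  | m + 3, hm, ih =>
    have h₁ := supportInvariants_containsNeighborhood k (n := n) m (by omega)
    have h₂ := ih m (by omega) (by omega)
    have := h₁.or_subset h₂ (x := ⟨m + 2, by omega⟩)
      (T := Finset.Icc ⟨m, by omega⟩ ⟨m + 1, by omega⟩) (by simp [Fin.le_def]) (by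
      rintro s ⟨w, hw, h⟩
      refine ⟨w, hw, fun i hi h₁ h₂ => ?_⟩
      have := h i i.2 h₁ h₂
      simp [Fin.le_def, Fin.ext_iff] at this
      rcases this with h | h | h
      · omega
      · omega
      · exact h) (by
      rintro s ⟨w, hw, h⟩
      refine ⟨w, hw, fun i hi h₁ h₂ => ?_⟩
      by_cases him : i.val < m
      · exact Finset.mem_union_right _ (h i him h₁ h₂)
      · refine Finset.mem_union_left _ ?_
        simp [Fin.le_def]
        omega)
    convert this using 1
    · funext s
      refine propext ⟨fun ⟨w, hw, h⟩ => ?_, ?_⟩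
      · by_cases hw' : w < m
        · exact Or.inl ⟨w, hw', fun i hi h₁ h₂ => h i (by omega) h₁ h₂⟩
        · refine Or.inr fun i hi => h i ?_ ?_ ?_ <;>
          · simp [Fin.le_def, Fin.ext_iff] at hi
            omega
      · rintro (⟨w, hw, h⟩ | h)
        · exact ⟨w, by omega, fun i hi h₁ h₂ => h i i.2 h₁ h₂⟩
        · refine ⟨m + 2, by omega, fun i hi h₁ h₂ => h ?_⟩
          simp [Fin.le_def, Fin.ext_iff]
          omega
    · simp
      split_ifs <;> omega
    · omega

theorem closedNeighborhoodIdeal_eq_squarefreeIdeal {V : Type*} [Fintype V] (G : SimpleGraph V) :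
    ∃ N : V → Finset V, (∀ v u, u ∈ N v ↔ u = v ∨ G.Adj v u) ∧
      closedNeighborhoodIdeal k G = squarefreeIdeal k (Set.range N) := by
  classical
  refine ⟨fun v => insert v (G.neighborFinset v), by simp, ?_⟩
  rw [closedNeighborhoodIdeal, squarefreeIdeal, ← Set.range_comp]
  congr!

theorem pathSquare_adj {i j : Fin n} :
    i = j ∨ (pathSquare n).Adj j i ↔ j.val ≤ i + 2 ∧ i.val ≤ j + 2 := by
  rw [pathSquare, SimpleGraph.sup_adj, SimpleGraph.pathGraph_adj, SimpleGraph.fromRel_adj,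
    Fin.ext_iff, Ne, Fin.ext_iff]
  omega

theorem hasInvariants_closedNeighborhoodIdeal (n : ℕ) :
    HasInvariants (V := Fin n) (quotientGrading (closedNeighborhoodIdeal k (pathSquare n)))
      (2 * (n / 3 : ℕ) + if n % 3 = 2 then 1 else 0) ((n + 2) / 3) := by
  obtain ⟨N, hN, hI⟩ := closedNeighborhoodIdeal_eq_squarefreeIdeal k (pathSquare n)
  rw [hI]
  refine (supportInvariants_containsNeighborhood_self k n le_rfl).hasInvariants fun s => ?_
  simp only [Set.exists_range_iff, Finset.subset_iff, hN, pathSquare_adj]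
  exact ⟨fun ⟨w, hw, h⟩ => ⟨⟨w, hw⟩, fun i hi => h i i.2 hi.1 hi.2⟩,
    fun ⟨w, h⟩ => ⟨w, w.2, fun i _ h₁ h₂ => h ⟨h₁, h₂⟩⟩⟩

end PathSquare

theorem theorem1 {k : Type*} [Field k] (n p d : ℕ) (hd : d ≤ 5) (hn : n = 6 * p + d) :
    (regularity (Fin n) (quotientGrading (closedNeighborhoodIdeal k (pathSquare n))) =
      (((if d = 0 ∨ d = 1 then 4 * (p : ℤ)
        else if d = 2 then 4 * (p : ℤ) + 1
        else if d = 3 ∨ d = 4 then 4 * (p : ℤ) + 2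
        else 4 * (p : ℤ) + 3 : ℤ) : WithTop ℤ) : WithBot (WithTop ℤ))) ∧
    (CategoryTheory.projectiveDimension
        (ModuleCat.of (MvPolynomial (Fin n) k)
          (MvPolynomial (Fin n) k ⧸ closedNeighborhoodIdeal k (pathSquare n))) =
      (((if d = 0 then 2 * p
        else if d = 1 ∨ d = 2 ∨ d = 3 then 2 * p + 1
        else 2 * p + 2 : ℕ) : ℕ∞) : WithBot ℕ∞)) := by
  have h := hasInvariants_closedNeighborhoodIdeal k n
  have hgr : ∀ f ∈ closedNeighborhoodIdeal k (pathSquare n), ∀ j,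
      homPart j f ∈ closedNeighborhoodIdeal k (pathSquare n) := by
    obtain ⟨N, -, hI⟩ := closedNeighborhoodIdeal_eq_squarefreeIdeal k (pathSquare n)
    rw [hI]
    exact fun f hf j => homPart_mem_squarefreeIdeal hf j
  constructor
  · obtain ⟨F, hF₁, hF₂, -⟩ := h
    rw [F.regularity_eq (isGradedFamily_quotientGrading hgr) hF₁ hF₂]
    congr 2
    split_ifs <;> omega
  · rw [h.projectiveDimension_eq]
    congr 2
    split_ifs <;> omega
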